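/- Let $d \ge 1$. A $d$-polytope is a full-dimensional convex polytope in $\mathbb{R}^d$. An inner diagonal of a $d$-polytope $P$ is a segment connecting two vertices of $P$ that meets the interior of $P$, and $P$ is illuminated if every vertex of $P$ lies on an inner diagonal. Put $M(d) = \min\{2d, \lceil(\sqrt{d}+1)^2\rceil\}$. A Mani $d$-polytope is an illuminated $d$-polytope that has exactly $M(d)$ vertices, this being the minimum number of vertices of an illuminated $d$-polytope (that is, no illuminated $d$-polytope has fewer vertices). Two polytopes have the same combinatorial type if their face lattices are isomorphic. Theorem. For $1 \le d \le 5$ there is exactly one combinatorial type of Mani $d$-polytopes, namely that of the $d$-dimensional crosspolytope $\operatorname{conv}\{\pm e_1, \ldots, \pm e_d\}$: the crosspolytope is a Mani $d$-polytope, and every Mani $d$-polytope has a face lattice isomorphic to that of the crosspolytope. -/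

import Mathlib

namespace Illum

/-- A `d`-polytope: the convex hull of a finite set of points in `ℝ^d`, full-dimensional. -/
def IsPolytope (d : ℕ) (P : Set (EuclideanSpace ℝ (Fin d))) : Prop :=
  (∃ V : Set (EuclideanSpace ℝ (Fin d)), V.Finite ∧ P = convexHull ℝ V) ∧ (interior P).Nonempty

/-- The vertex set of `P`. -/
def verts {d : ℕ} (P : Set (EuclideanSpace ℝ (Fin d))) : Set (EuclideanSpace ℝ (Fin d)) :=
  P.extremePoints ℝ

/-- The number of vertices of `P` (the vertex set of a polytope is finite). -/
noncomputable def f₀ {d : ℕ} (P : Set (EuclideanSpace ℝ (Fin d))) : ℕ :=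
  (verts P).ncard

/-- The segment `[u, v]` is an inner diagonal of `P`: it connects two vertices and
passes through the interior of `P`. -/
def IsInnerDiagonal {d : ℕ} (P : Set (EuclideanSpace ℝ (Fin d)))
    (u v : EuclideanSpace ℝ (Fin d)) : Prop :=
  u ∈ verts P ∧ v ∈ verts P ∧ u ≠ v ∧ (segment ℝ u v ∩ interior P).Nonempty

/-- An illuminated `d`-polytope: every vertex lies on an inner diagonal. -/
def IsIlluminated (d : ℕ) (P : Set (EuclideanSpace ℝ (Fin d))) : Prop :=
  IsPolytope d P ∧
    ∀ x ∈ verts P, ∃ u v, IsInnerDiagonal P u v ∧ x ∈ segment ℝ u v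

/-- `M(d) = min {2d, ⌈(√d + 1)²⌉}`. -/
noncomputable def maniNumber (d : ℕ) : ℕ :=
  min (2 * d) ⌈(Real.sqrt (d : ℝ) + 1) ^ 2⌉₊

/-- A Mani `d`-polytope: an illuminated `d`-polytope on `M(d)` vertices, this being the minimal
number of vertices of an illuminated `d`-polytope. -/
def IsMani (d : ℕ) (P : Set (EuclideanSpace ℝ (Fin d))) : Prop :=
  IsIlluminated d P ∧ f₀ P = maniNumber d ∧
    ∀ Q : Set (EuclideanSpace ℝ (Fin d)), IsIlluminated d Q → f₀ P ≤ f₀ Q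

/-- The faces of `P`, ordered by inclusion. Both `∅` and `P` are faces. -/
abbrev Face {d : ℕ} (P : Set (EuclideanSpace ℝ (Fin d))) : Type :=
  {F : Set (EuclideanSpace ℝ (Fin d)) // IsExposed ℝ P F}

/-- `P` and `Q` have the same combinatorial type: their face lattices are isomorphic. -/
def CombEquiv {d e : ℕ} (P : Set (EuclideanSpace ℝ (Fin d)))
    (Q : Set (EuclideanSpace ℝ (Fin e))) : Prop :=
  Nonempty (Face P ≃o Face Q)

/-- The `d`-dimensional crosspolytope, the convex hull of `± e₁, …, ± e_d`. -/
def crosspolytope (d : ℕ) : Set (EuclideanSpace ℝ (Fin d)) :=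
  convexHull ℝ (Set.range (fun i : Fin d => EuclideanSpace.single i (1 : ℝ)) ∪
    Set.range (fun i : Fin d => -EuclideanSpace.single i (1 : ℝ)))

end Illum

/-!
The proof works with the space of affine dependences of the `n` vertices of an illuminated
`d`-polytope `P`, which has dimension `n - d - 1` (`finrank_affDeps`). An inner diagonal yields a
dependence that is positive at all vertices except its two endpoints (`isDiag_of_mem_interior`),
whereas no dependence is positive away from a single vertex (`no_single_nonpos`). Consequently the
dependences of inner diagonals that pairwise meet at most in one fixed vertex `c` admit only linear
relations with coefficients of one sign, and none but the trivial one if the diagonals leave a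
vertex uncovered (`relation_one_signed`, `linearIndependent_deps`).

As `P` is illuminated, its inner diagonals form a graph without isolated vertices, which is covered
by disjoint stars (`exists_star_cover`). Applying the independence statement to all diagonals of the
cover, or to those of a largest star and one from each other star, bounds the dimension
`n - d - 1` from below. For `d ≤ 5` this rules out `n < 2 d`, and for `n = 2 d` it forces the
cover to be a perfect matching (`exists_diag_matching`).

In that case the dependences of the `d` matching diagonals span the space of all dependences, which
has dimension `d - 1`, and satisfy a positive linear relation. A Perron–Frobenius argument
(`exists_pos_kernel`) turns this into a supporting hyperplane for every set consisting of one
endpoint of each diagonal (`exists_functional_of_matching`). Since no proper face contains both ends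
of an inner diagonal, the vertex sets of the proper faces are exactly the sets without a matched
pair, just as for the crosspolytope (`IsCrosslike.nonempty_orderIso`).
-/

/-! ### Affine dependences and their signs -/

namespace Illum

open Finset Module

variable {ι κ E : Type*} [Fintype ι] [Fintype κ] [AddCommGroup E] [Module ℝ E]

/-- The space of affine dependences of a finite family `v` of points: the weights `w` with
`∑ w i = 0` and `∑ w i • v i = 0`, packaged as the kernel of the linear map that sends `w` to
`∑ w i • (1, v i)`. -/
def affDeps (v : ι → E) : Submodule ℝ (ι → ℝ) :=
  LinearMap.ker (Fintype.linearCombination ℝ (fun i => ((1 : ℝ), v i)))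

lemma mem_affDeps {v : ι → E} {w : ι → ℝ} :
    w ∈ affDeps v ↔ ∑ i, w i = 0 ∧ ∑ i, w i • v i = 0 := by
  simp [affDeps, Fintype.linearCombination_apply, Prod.ext_iff, Prod.fst_sum, Prod.snd_sum]

lemma linearCombination_one_surjective {v : ι → E} (hv : affineSpan ℝ (Set.range v) = ⊤) :
    Function.Surjective (Fintype.linearCombination ℝ (fun i => ((1 : ℝ), v i))) := by
  have key : ∀ p : E, ∃ w : ι → ℝ, ∑ i, w i = 1 ∧ ∑ i, w i • v i = p := by
    intro p
    obtain ⟨w, hw, hp⟩ := eq_affineCombination_of_mem_affineSpan_of_fintype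
      (p1 := p) (p := v) (by rw [hv]; trivial)
    refine ⟨w, hw, ?_⟩
    rw [hp, Finset.affineCombination_eq_linear_combination _ _ _ hw]
  rintro ⟨a, p⟩
  obtain ⟨w, hw, hp⟩ := key p
  obtain ⟨u, hu, hq⟩ := key 0
  refine ⟨w + (a - 1) • u, ?_⟩
  rw [map_add, map_smul]
  simp [Fintype.linearCombination_apply, Prod.ext_iff, Prod.fst_sum, Prod.snd_sum, hw, hp, hu, hq]

lemma finrank_affDeps [FiniteDimensional ℝ E] {v : ι → E}
    (hv : affineSpan ℝ (Set.range v) = ⊤) :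
    finrank ℝ (affDeps v) + (finrank ℝ E + 1) = Fintype.card ι := by
  have h := LinearMap.finrank_range_add_finrank_ker
    (Fintype.linearCombination ℝ (fun i => ((1 : ℝ), v i)))
  rw [LinearMap.range_eq_top.2 (linearCombination_one_surjective hv), finrank_top,
    Module.finrank_prod, Module.finrank_self, Module.finrank_fintype_fun_eq_card] at h
  rw [affDeps]
  omega

/-- A function on the index set that is orthogonal to all affine dependences is the restriction of
an affine functional. -/
lemma exists_affine_functional {v : ι → E}
    (h : ι → ℝ) (hh : ∀ w ∈ affDeps v, ∑ i, w i * h i = 0) :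
    ∃ (l : E →ₗ[ℝ] ℝ) (a : ℝ), ∀ i, l (v i) + a = h i := by
  classical
  set L := Fintype.linearCombination ℝ (fun i => ((1 : ℝ), v i)) with hL
  have hm : Fintype.linearCombination ℝ h ∈ (LinearMap.ker L).dualAnnihilator := by
    rw [Submodule.mem_dualAnnihilator]
    intro w hw
    simpa [Fintype.linearCombination_apply] using hh w hw
  rw [← LinearMap.range_dualMap_eq_dualAnnihilator_ker] at hm
  obtain ⟨g, hg⟩ := hm
  refine ⟨g ∘ₗ LinearMap.inr ℝ ℝ E, g (1, 0), fun i => ?_⟩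
  have h1 := congrArg (fun φ => φ (Pi.single i 1)) hg
  simp [hL, LinearMap.dualMap_apply] at h1
  rw [← h1]
  simp [← map_add]

/-- The sign obstruction behind all rank bounds: if `v` is in convex position, an affine dependence
cannot be positive away from a single index `c`, since it would write `v c` as a convex combination
of the other points. -/
lemma no_single_nonpos [Nontrivial ι] {v : ι → E} (hv : ConvexIndependent ℝ v) {w : ι → ℝ}
    (hw : w ∈ affDeps v) (c : ι) (hpos : ∀ z, z ≠ c → 0 < w z) : False := by
  classical
  obtain ⟨h0, h1⟩ := mem_affDeps.1 hw
  obtain ⟨z, hz⟩ := exists_ne c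
  rw [← Finset.add_sum_erase _ _ (mem_univ c)] at h0 h1
  have hp : ∀ i ∈ univ.erase c, 0 < w i := fun i hi => hpos i (ne_of_mem_erase hi)
  have hS : 0 < ∑ i ∈ univ.erase c, w i :=
    Finset.sum_pos hp ⟨z, by simp [hz]⟩
  have hmem : (univ.erase c).centerMass w v ∈ convexHull ℝ (v '' {c}ᶜ) :=
    Finset.centerMass_mem_convexHull _ (fun i hi => (hp i hi).le) hS
      (fun i hi => ⟨i, by simpa using hi, rfl⟩)
  have hc : (univ.erase c).centerMass w v = v c := by
    have e0 : ∑ i ∈ univ.erase c, w i = - w c := by linarith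
    have e1 : ∑ i ∈ univ.erase c, w i • v i = (- w c) • v c := by
      rw [neg_smul]; exact eq_neg_of_add_eq_zero_right h1
    rw [Finset.centerMass, e1, e0, smul_smul, inv_mul_cancel₀ (by linarith), one_smul]
  rw [hc] at hmem
  exact hv _ _ hmem rfl

lemma coe_sum_smul_apply {v : ι → E} (f : κ → ℝ) (w : κ → affDeps v) (x : ι) :
    (∑ k, f k • w k : affDeps v).1 x = ∑ k, f k * (w k).1 x := by
  simp [Finset.sum_apply]

/-- Suppose that the dependence `w k` is positive outside `N k` and that distinct sets `N k` meet
at most in `c`. Then all coefficients of a linear relation between the `w k` have the same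
sign: otherwise the positive and the negative part of the relation are two expressions of one
dependence, and at each index other than `c` one of them is visibly positive. -/
lemma relation_one_signed [Nontrivial ι] {v : ι → E} (hv : ConvexIndependent ℝ v)
    {w : κ → affDeps v} {N : κ → Set ι} (hw : ∀ k, ∀ z ∉ N k, 0 < (w k).1 z) {c : ι}
    (hN : ∀ k k', k ≠ k' → ∀ z ∈ N k, z ∈ N k' → z = c) {f : κ → ℝ}
    (hf : ∑ k, f k • w k = 0) : (∀ k, 0 ≤ f k) ∨ (∀ k, f k ≤ 0) := by
  by_contra! hcon
  obtain ⟨⟨k₁, hk₁⟩, ⟨k₂, hk₂⟩⟩ := hcon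
  have hsplit : ∑ k, (f k)⁺ • w k = ∑ k, (f k)⁻ • w k := by
    have h0 : ∀ x, ∑ k, f k * (w k).1 x = 0 := fun x => by
      rw [← coe_sum_smul_apply f w, hf]; rfl
    ext x
    rw [coe_sum_smul_apply, coe_sum_smul_apply, ← sub_eq_zero, ← Finset.sum_sub_distrib, ← h0 x]
    refine Finset.sum_congr rfl fun k _ => ?_
    rw [← sub_mul, posPart_sub_negPart]
  refine no_single_nonpos hv (∑ k, (f k)⁺ • w k).2 c fun z hz => ?_
  by_cases h : ∃ k, 0 < f k ∧ z ∈ N k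
  · obtain ⟨k, hk, hzk⟩ := h
    rw [hsplit, coe_sum_smul_apply]
    have hout : ∀ k', f k' < 0 → z ∉ N k' := fun k' hk' hz' =>
      hz (hN k k' (by rintro rfl; linarith) z hzk hz')
    refine Finset.sum_pos' (fun k' _ => ?_) ⟨k₁, mem_univ _, ?_⟩
    · rcases lt_or_ge (f k') 0 with h' | h'
      · exact mul_nonneg (negPart_nonneg _) (hw k' z (hout k' h')).le
      · simp [negPart_eq_zero.2 h']
    · exact mul_pos (negPart_pos hk₁) (hw _ _ (hout _ hk₁))
  · push Not at h
    rw [coe_sum_smul_apply]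
    refine Finset.sum_pos' (fun k' _ => ?_) ⟨k₂, mem_univ _, ?_⟩
    · rcases lt_or_ge 0 (f k') with h' | h'
      · exact mul_nonneg (posPart_nonneg _) (hw k' z (h k' h')).le
      · simp [posPart_eq_zero.2 h']
    · exact mul_pos (posPart_pos hk₂) (hw _ _ (h _ hk₂))

lemma sum_neg_smul_eq_zero {v : ι → E} {f : κ → ℝ} {w : κ → affDeps v}
    (hf : ∑ k, f k • w k = 0) : ∑ k, (-f k) • w k = 0 := by
  ext x
  have h : (∑ k, f k • w k : affDeps v).1 x = 0 := by rw [hf]; rfl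
  rw [coe_sum_smul_apply] at h ⊢
  simpa using h

lemma nonneg_relation_eq_zero {v : ι → E} {w : κ → affDeps v} {N : κ → Set ι}
    (hw : ∀ k, ∀ z ∉ N k, 0 < (w k).1 z) {f : κ → ℝ} (hf : ∑ k, f k • w k = 0)
    (hf0 : ∀ k, 0 ≤ f k) {x : ι} (hx : ∀ k, f k ≠ 0 → x ∉ N k) (k : κ) : f k = 0 := by
  by_contra hk
  have h : (∑ k, f k • w k : affDeps v).1 x = 0 := by rw [hf]; rfl
  rw [coe_sum_smul_apply] at h
  refine absurd h (Finset.sum_pos' (fun k' _ => ?_) ⟨k, mem_univ _, ?_⟩).ne'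
  · by_cases h' : f k' = 0
    · simp [h']
    · exact mul_nonneg (hf0 k') (hw _ _ (hx _ h')).le
  · exact mul_pos (lt_of_le_of_ne (hf0 k) (Ne.symm hk)) (hw _ _ (hx _ hk))

lemma relation_eq_zero [Nontrivial ι] {v : ι → E} (hv : ConvexIndependent ℝ v)
    {w : κ → affDeps v} {N : κ → Set ι} (hw : ∀ k, ∀ z ∉ N k, 0 < (w k).1 z) {c : ι}
    (hN : ∀ k k', k ≠ k' → ∀ z ∈ N k, z ∈ N k' → z = c) {f : κ → ℝ}
    (hf : ∑ k, f k • w k = 0) {x : ι} (hx : ∀ k, f k ≠ 0 → x ∉ N k) (k : κ) : f k = 0 := by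
  rcases relation_one_signed hv hw hN hf with h | h
  · exact nonneg_relation_eq_zero hw hf h hx k
  · have := nonneg_relation_eq_zero (f := fun k => - f k) hw
      (sum_neg_smul_eq_zero hf)
      (fun k => by simpa using h k) (x := x) (fun k hk => hx k (by simpa using hk)) k
    simpa using this

/-- If in addition some index lies in none of the sets `N k`, there is no nontrivial relation. -/
lemma linearIndependent_deps [Nontrivial ι] {v : ι → E} (hv : ConvexIndependent ℝ v)
    {w : κ → affDeps v} {N : κ → Set ι} (hw : ∀ k, ∀ z ∉ N k, 0 < (w k).1 z) {c : ι}
    (hN : ∀ k k', k ≠ k' → ∀ z ∈ N k, z ∈ N k' → z = c) {x : ι} (hx : ∀ k, x ∉ N k) :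
    LinearIndependent ℝ w := by
  rw [Fintype.linearIndependent_iff]
  intro f hf
  exact relation_eq_zero hv hw hN hf (fun k _ => hx k)

/-- Perron–Frobenius for a square matrix with positive off-diagonal entries whose rows admit a
positive linear relation: its kernel contains a positive vector. -/
lemma exists_pos_kernel [Nonempty κ] (A : κ → κ → ℝ) (hA : ∀ i j, i ≠ j → 0 < A i j)
    (g : κ → ℝ) (hg : ∀ i, 0 < g i) (hgA : ∀ j, ∑ i, g i * A i j = 0) :
    ∃ p : κ → ℝ, (∀ j, 0 < p j) ∧ ∀ i, ∑ j, A i j * p j = 0 := by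
  classical
  have hdet : (Matrix.of A).det = 0 := by
    refine Matrix.exists_vecMul_eq_zero_iff.1 ⟨g, ?_, ?_⟩
    · intro h
      obtain ⟨i⟩ := ‹Nonempty κ›
      have := hg i
      simp [h] at this
    · ext j
      simpa [Matrix.vecMul, dotProduct] using hgA j
  obtain ⟨p, hp0, hp⟩ := Matrix.exists_mulVec_eq_zero_iff.2 hdet
  have hp' : ∀ i, ∑ j, A i j * p j = 0 := fun i => by
    simpa [Matrix.mulVec, dotProduct] using congrFun hp i
  -- Summing the rows, weighted by `g`, over the indices with a positive entry shows that no kernel vector has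
  -- both a positive and a nonpositive entry.
  have key : ∀ q : κ → ℝ, (∀ i, ∑ j, A i j * q j = 0) → ∀ a, 0 < q a → ∀ b, 0 < q b := by
    intro q hq a ha b
    by_contra hb
    set S := univ.filter fun i => 0 < q i with hS
    have h0 : ∑ j, (∑ i ∈ S, g i * A i j) * q j = 0 := by
      simp_rw [Finset.sum_mul]
      rw [Finset.sum_comm]
      refine Finset.sum_eq_zero fun i _ => ?_
      simp_rw [mul_assoc]
      rw [← Finset.mul_sum, hq, mul_zero]
    have hle : ∀ j, (∑ i ∈ S, g i * A i j) * q j ≤ 0 ∧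
        (0 < q j → (∑ i ∈ S, g i * A i j) * q j < 0) := by
      intro j
      by_cases hj : 0 < q j
      · have h1 : ∑ i ∈ S, g i * A i j + ∑ i ∈ Sᶜ, g i * A i j = 0 := by
          rw [Finset.sum_add_sum_compl]; exact hgA j
        have h2 : 0 < ∑ i ∈ Sᶜ, g i * A i j := by
          refine Finset.sum_pos (fun i hi => mul_pos (hg i) (hA i j ?_)) ⟨b, by simpa [hS] using hb⟩
          rintro rfl
          simp [hS] at hi
          linarith
        have h3 : (∑ i ∈ S, g i * A i j) * q j < 0 := mul_neg_of_neg_of_pos (by linarith) hj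
        exact ⟨h3.le, fun _ => h3⟩
      · refine ⟨mul_nonpos_of_nonneg_of_nonpos (Finset.sum_nonneg fun i hi => ?_)
          (not_lt.1 hj), fun h => absurd h hj⟩
        refine (mul_pos (hg i) (hA i j ?_)).le
        rintro rfl
        exact hj (by simpa [hS] using hi)
    have := Finset.sum_lt_sum (f := fun j => (∑ i ∈ S, g i * A i j) * q j) (g := fun _ => 0)
      (s := univ) (fun j _ => (hle j).1) ⟨a, mem_univ _, (hle a).2 ha⟩
    simp [h0] at this
  obtain ⟨a, ha⟩ := Function.ne_iff.1 hp0
  rcases lt_or_gt_of_ne ha with h | h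
  · refine ⟨fun j => - p j, key _ (fun i => by simp [hp']) a (by simpa using h),
      fun i => by simp [hp']⟩
  · exact ⟨p, key _ hp' a h, hp'⟩

end Illum

/-! ### Star covers and the matching of inner diagonals -/

namespace Illum

open Finset Module

section StarCover

variable {ι : Type*} [Finite ι]

/-- Every graph without isolated vertices on a finite vertex set can be covered by disjoint stars:
`C` is the set of centres, and `c` sends each remaining vertex to the centre of its star. The stars
are the components of a minimal edge cover, in which every edge has an endpoint that no other edge
covers. -/
lemma exists_star_cover {R : ι → ι → Prop} (hsymm : ∀ x y, R x y → R y x)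
    (hR : ∀ x, ∃ y, y ≠ x ∧ R x y) :
    ∃ (C : Set ι) (c : ι → ι), (∀ x ∉ C, c x ∈ C ∧ R x (c x)) ∧ ∀ y ∈ C, ∃ x ∉ C, c x = y := by
  classical
  obtain ⟨S, hS⟩ := exists_minimal_of_wellFoundedLT
    (fun S : Set (ι × ι) => (∀ e ∈ S, R e.1 e.2 ∧ e.1 ≠ e.2) ∧ ∀ x, ∃ e ∈ S, x = e.1 ∨ x = e.2)
    ⟨{e | R e.1 e.2 ∧ e.1 ≠ e.2}, fun e he => he, fun x => by
      obtain ⟨y, hy, hxy⟩ := hR x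
      exact ⟨(x, y), ⟨hxy, hy.symm⟩, Or.inl rfl⟩⟩
  obtain ⟨hSR, hScov⟩ := hS.prop
  have hpriv : ∀ e : S, ∃ x, (x = e.1.1 ∨ x = e.1.2) ∧
      ∀ e' : S, (x = e'.1.1 ∨ x = e'.1.2) → e' = e := by
    intro e
    by_contra! hcon
    have hle := hS.le_of_le (y := S \ {e.1}) ⟨fun e' he' => hSR e' he'.1, fun x => by
      obtain ⟨e', he', hx⟩ := hScov x
      by_cases h : e' = e.1
      · subst h
        obtain ⟨e'', he'', hne⟩ := hcon x hx
        exact ⟨e''.1, ⟨e''.2, fun h => hne (Subtype.ext h)⟩, he''⟩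
      · exact ⟨e', ⟨he', h⟩, hx⟩⟩ Set.sdiff_subset
    exact (hle e.2).2 rfl
  choose leaf hleaf huniq using hpriv
  have hother : ∀ x, ∃ y, ∀ e : S, leaf e = x →
      y ∉ Set.range leaf ∧ R x y ∧ ∀ z, (z = e.1.1 ∨ z = e.1.2) → z ≠ x → z = y := by
    intro x
    by_cases hx : ∃ e, leaf e = x
    · obtain ⟨e, rfl⟩ := hx
      have hone : ∀ e' : S, leaf e' = leaf e → e' = e := fun e' h =>
        huniq e e' (h ▸ hleaf e')
      have hend : ∀ y, (y = e.1.1 ∨ y = e.1.2) → y ≠ leaf e → y ∉ Set.range leaf := by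
        rintro y hy hne ⟨e', rfl⟩
        exact hne (by rw [huniq e' e hy])
      obtain ⟨h1, h2⟩ := hSR e.1 e.2
      rcases hleaf e with h | h
      · refine ⟨e.1.2, fun e' he' => ?_⟩
        rw [hone e' he']
        refine ⟨hend _ (Or.inr rfl) (by rw [h]; exact h2.symm), by rw [h]; exact h1, ?_⟩
        rintro z (hz | hz) hzne
        · exact absurd (hz.trans h.symm) hzne
        · exact hz
      · refine ⟨e.1.1, fun e' he' => ?_⟩
        rw [hone e' he']
        refine ⟨hend _ (Or.inl rfl) (by rw [h]; exact h2), by rw [h]; exact hsymm _ _ h1, ?_⟩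
        rintro z (hz | hz) hzne
        · exact hz
        · exact absurd (hz.trans h.symm) hzne
    · exact ⟨x, fun e he => absurd ⟨e, he⟩ hx⟩
  choose c hc using hother
  refine ⟨(Set.range leaf)ᶜ, c, fun x hx => ?_, fun y hy => ?_⟩
  · obtain ⟨e, rfl⟩ := Set.notMem_compl_iff.1 hx
    exact ⟨(hc _ e rfl).1, (hc _ e rfl).2.1⟩
  · obtain ⟨e, he, hye⟩ := hScov y
    refine ⟨leaf ⟨e, he⟩, fun h => h ⟨_, rfl⟩, ?_⟩
    exact ((hc _ ⟨e, he⟩ rfl).2.2 y hye (fun h => hy ⟨_, h.symm⟩)).symm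

end StarCover

variable {ι E : Type*} [Fintype ι] [AddCommGroup E] [Module ℝ E]

/-- In Gale-dual terms, `x` and `y` span an inner diagonal of the convex hull of `v`: some affine
dependence is positive at all other indices. -/
def IsDiag (v : ι → E) (x y : ι) : Prop :=
  ∃ w ∈ affDeps v, ∀ z, z ≠ x → z ≠ y → 0 < w z

/-- Inner diagonals `{x, c x}` that meet only in `y₀` and leave some vertex `z` uncovered have
linearly independent dependences. -/
lemma card_le_finrank_affDeps [Nontrivial ι] {v : ι → E} (hv : ConvexIndependent ℝ v)
    (K : Finset ι) (c : ι → ι) (hK : ∀ x ∈ K, IsDiag v x (c x)) (hcK : ∀ x ∈ K, c x ∉ K) (y₀ : ι)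
    (hmeet : ∀ x ∈ K, ∀ x' ∈ K, x ≠ x' → c x = c x' → c x = y₀) (z : ι) (hz : z ∉ K)
    (hzc : ∀ x ∈ K, z ≠ c x) : K.card ≤ finrank ℝ (affDeps v) := by
  choose! w hw hpos using hK
  have hli := linearIndependent_deps (κ := K) hv (w := fun k => ⟨w k.1, hw k.1 k.2⟩)
    (N := fun k => {k.1, c k.1}) (c := y₀) (x := z) ?_ ?_ ?_
  · simpa using hli.fintype_card_le_finrank
  · intro k x hx
    simp only [Set.mem_insert_iff, Set.mem_singleton_iff, not_or] at hx
    exact hpos k.1 k.2 x hx.1 hx.2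
  · rintro ⟨k, hk⟩ ⟨k', hk'⟩ hne x hx hx'
    have hne' : k ≠ k' := fun h => hne (Subtype.ext h)
    simp only [Set.mem_insert_iff, Set.mem_singleton_iff] at hx hx'
    rcases hx with rfl | rfl
    · rcases hx' with rfl | h
      · exact absurd rfl hne'
      · exact absurd (h ▸ hk) (hcK _ hk')
    · rcases hx' with h | h
      · exact absurd (h ▸ hk') (hcK _ hk)
      · exact hmeet _ hk _ hk' hne' h
  · rintro ⟨k, hk⟩ hzk
    simp only [Set.mem_insert_iff, Set.mem_singleton_iff] at hzk
    rcases hzk with rfl | h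
    · exact hz hk
    · exact hzc k hk h

/-- The counting argument, for a graph `R` of inner diagonals without isolated vertices. Cover the
graph by `k` stars. If at most one star has two or more leaves, all diagonals of the cover but one
are independent, so `k ≥ d`. Otherwise the diagonals of a largest star, with `s` leaves, together
with one diagonal from each other star are independent, so `s + k + d ≤ n ≤ k (s + 1)`, which is
impossible for `n ≤ 2 d ≤ 10`. -/
lemma exists_diag_matching [FiniteDimensional ℝ E] {v : ι → E} (hv : ConvexIndependent ℝ v)
    (hspan : affineSpan ℝ (Set.range v) = ⊤) {d : ℕ} (hd : finrank ℝ E = d) (hd₁ : 1 ≤ d)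
    (hd₅ : d ≤ 5) {R : ι → ι → Prop} (hsymm : ∀ x y, R x y → R y x)
    (hdiag : ∀ x y, R x y → IsDiag v x y) (hR : ∀ x, ∃ y, y ≠ x ∧ R x y)
    (hcard : Fintype.card ι ≤ 2 * d) :
    ∃ e : Fin d × Bool ≃ ι, ∀ i, R (e (i, true)) (e (i, false)) := by
  classical
  have hrank := finrank_affDeps hspan
  rw [hd] at hrank
  have : Nontrivial ι := Fintype.one_lt_card_iff_nontrivial.1 (by omega)
  obtain ⟨C', c, hc, hsurj⟩ := exists_star_cover hsymm hR
  obtain ⟨C, rfl⟩ : ∃ C : Finset ι, (C : Set ι) = C' := ⟨C'.toFinset, by simp⟩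
  simp only [Finset.mem_coe] at hc hsurj
  choose! r hrC hrc using hsurj
  have hCne : C.Nonempty := by
    obtain ⟨x⟩ := (inferInstance : Nonempty ι)
    by_cases hx : x ∈ C
    · exact ⟨x, hx⟩
    · exact ⟨_, (hc x hx).1⟩
  -- `s y` is the number of leaves at the centre `y`.
  set s : ι → ℕ := fun y => (Cᶜ.filter fun x => c x = y).card with hs
  obtain ⟨y₀, hy₀, hmax⟩ := C.exists_max_image s hCne
  have hmaps : ∀ x ∈ Cᶜ, c x ∈ C := fun x hx => (hc x (by simpa using hx)).1
  have hsum : (Cᶜ).card = ∑ y ∈ C, s y := Finset.card_eq_sum_card_fiberwise hmaps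
  have hn : C.card + (Cᶜ).card = Fintype.card ι := Finset.card_add_card_compl C
  have hrinj : Set.InjOn r C := fun y hy y' hy' h => by rw [← hrc y hy, h, hrc y' hy']
  have hkL : C.card ≤ (Cᶜ).card :=
    Finset.card_le_card_of_injOn r (fun y hy => by simpa using hrC y hy) hrinj
  by_cases hbig : ∃ y₁ ∈ C, y₁ ≠ y₀ ∧ 2 ≤ s y₁
  · exfalso
    obtain ⟨y₁, hy₁, hne, hs₁⟩ := hbig
    obtain ⟨z, hz, hzr⟩ := Finset.exists_mem_ne hs₁ (r y₁)
    simp only [mem_filter, mem_compl] at hz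
    have hdisj : Disjoint (Cᶜ.filter fun x => c x = y₀) ((C.erase y₀).image r) := by
      rw [Finset.disjoint_left]
      intro x hx hx'
      obtain ⟨y, hy, rfl⟩ := mem_image.1 hx'
      rw [mem_erase] at hy
      exact hy.1 (by rw [← hrc y hy.2]; exact (mem_filter.1 hx).2)
    have hK := card_le_finrank_affDeps hv
      ((Cᶜ.filter fun x => c x = y₀) ∪ (C.erase y₀).image r) c ?_ ?_ y₀ ?_ z ?_ ?_
    · rw [card_union_of_disjoint hdisj,
        card_image_of_injOn (hrinj.mono (by simp)),
        card_erase_of_mem hy₀] at hK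
      have hle : (Cᶜ).card ≤ C.card * s y₀ := by
        rw [hsum, ← smul_eq_mul]
        exact Finset.sum_le_card_nsmul _ _ _ hmax
      have hk2 : 1 < C.card := Finset.one_lt_card.2 ⟨y₁, hy₁, y₀, hy₀, hne⟩
      have hs0 : 2 ≤ s y₀ := hs₁.trans (hmax _ hy₁)
      change s y₀ + _ ≤ _ at hK
      generalize s y₀ = a at *
      generalize C.card = k at *
      have h1 : a + k ≤ 5 := by omega
      have h2 : a ≤ 3 := by omega
      have h3 : k ≤ 3 := by omega
      interval_cases a <;> interval_cases k <;> omega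
    · intro x hx
      rcases mem_union.1 hx with hx | hx
      · exact hdiag _ _ (hc x (by simpa using (mem_filter.1 hx).1)).2
      · obtain ⟨y, hy, rfl⟩ := mem_image.1 hx
        exact hdiag _ _ (hc _ (hrC y (mem_of_mem_erase hy))).2
    · intro x hx hx'
      have hC : ∀ x ∈ (Cᶜ.filter fun x => c x = y₀) ∪ (C.erase y₀).image r, x ∉ C := by
        intro x hx
        rcases mem_union.1 hx with hx | hx
        · simpa using (mem_filter.1 hx).1
        · obtain ⟨y, hy, rfl⟩ := mem_image.1 hx
          exact hrC y (mem_of_mem_erase hy)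
      exact hC _ hx' (hc x (hC x hx)).1
    · intro x hx x' hx' hxx hcc
      rcases mem_union.1 hx with hx | hx
      · exact (mem_filter.1 hx).2
      rcases mem_union.1 hx' with hx' | hx'
      · rw [hcc]; exact (mem_filter.1 hx').2
      obtain ⟨y, hy, rfl⟩ := mem_image.1 hx
      obtain ⟨y', hy', rfl⟩ := mem_image.1 hx'
      rw [hrc y (mem_of_mem_erase hy), hrc y' (mem_of_mem_erase hy')] at hcc
      exact absurd (congrArg r hcc) hxx
    · intro hzK
      rcases mem_union.1 hzK with h | h
      · exact hne (hz.2.symm.trans (mem_filter.1 h).2)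
      · obtain ⟨y, hy, rfl⟩ := mem_image.1 h
        rw [hrc y (mem_of_mem_erase hy)] at hz
        exact hzr (by rw [hz.2])
    · intro x hx hzx
      refine hz.1 (hzx ▸ (hc x ?_).1)
      rcases mem_union.1 hx with hx | hx
      · simpa using (mem_filter.1 hx).1
      · obtain ⟨y, hy, rfl⟩ := mem_image.1 hx
        exact hrC y (mem_of_mem_erase hy)
  · push Not at hbig
    have hz : r y₀ ∈ Cᶜ := by simpa using hrC y₀ hy₀
    have hK := card_le_finrank_affDeps hv (Cᶜ.erase (r y₀)) c ?_ ?_ y₀ ?_ (r y₀) ?_ ?_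
    · rw [card_erase_of_mem hz] at hK
      have hk : C.card = d := by omega
      have hL : (Cᶜ).card = d := by omega
      let leaf : Fin d ≃ {x // x ∈ Cᶜ} := (Finset.equivFinOfCardEq hL).symm
      have hsurj : Function.Surjective
          (fun q : Fin d × Bool => if q.2 then (leaf q.1).1 else c (leaf q.1).1) := by
        intro x
        by_cases hx : x ∈ C
        · exact ⟨(leaf.symm ⟨r x, by simpa using hrC x hx⟩, false), by simp [hrc x hx]⟩
        · exact ⟨(leaf.symm ⟨x, by simpa using hx⟩, true), by simp⟩
      have hbij := hsurj.bijective_of_nat_card_le (by simp; omega)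
      exact ⟨Equiv.ofBijective _ hbij, fun i => by
        simpa using (hc _ (mem_compl.1 (leaf i).2)).2⟩
    · exact fun x hx => hdiag _ _ (hc x (by simpa using mem_of_mem_erase hx)).2
    · intro x hx hx'
      exact (mem_compl.1 (mem_of_mem_erase hx')) (hmaps x (mem_of_mem_erase hx))
    · intro x hx x' hx' hxx hcc
      by_contra hcon
      refine absurd (hbig _ (hmaps x (mem_of_mem_erase hx)) hcon) (not_lt.2 ?_)
      exact Finset.one_lt_card.2 ⟨x, mem_filter.2 ⟨mem_of_mem_erase hx, rfl⟩, x',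
        mem_filter.2 ⟨mem_of_mem_erase hx', hcc.symm⟩, hxx⟩
    · simp
    · intro x hx h
      exact (mem_compl.1 hz) (h ▸ hmaps x (mem_of_mem_erase hx))

/-- When `2 d` points in convex position are matched by inner diagonals, every transversal of the
matching is cut out by a supporting hyperplane. Indeed the dependences of the `d` diagonals span all
dependences and satisfy a positive relation, so `exists_pos_kernel` provides positive values on the
endpoints not chosen by `T` that, extended by zero to those chosen, are orthogonal to all
dependences and hence come from an affine functional. -/
lemma exists_functional_of_matching [FiniteDimensional ℝ E] {v : ι → E}
    (hv : ConvexIndependent ℝ v) (hspan : affineSpan ℝ (Set.range v) = ⊤) {d : ℕ}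
    (hd : finrank ℝ E = d) (hd₁ : 1 ≤ d) (e : Fin d × Bool ≃ ι)
    (he : ∀ i, IsDiag v (e (i, true)) (e (i, false))) (T : Fin d → Bool) :
    ∃ (l : E →ₗ[ℝ] ℝ) (a : ℝ), ∀ i, l (v (e (i, T i))) = a ∧ l (v (e (i, !T i))) < a := by
  classical
  have hrank := finrank_affDeps hspan
  have hcard : Fintype.card ι = d * 2 := by simp [← Fintype.card_congr e]
  rw [hd] at hrank
  have : Nontrivial ι := Fintype.one_lt_card_iff_nontrivial.1 (by omega)
  have : NeZero d := ⟨by omega⟩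
  choose w hw hpos using he
  set W : Fin d → affDeps v := fun i => ⟨w i, hw i⟩ with hW
  set N : Fin d → Set ι := fun i => {e (i, true), e (i, false)} with hN
  have hWN : ∀ k, ∀ z ∉ N k, 0 < (W k).1 z := by
    intro k z hz
    simp only [hN, Set.mem_insert_iff, Set.mem_singleton_iff, not_or] at hz
    exact hpos k z hz.1 hz.2
  have hmemN : ∀ k q, e q ∈ N k ↔ q.1 = k := by
    rintro k ⟨i, b⟩
    cases b <;> simp [hN]
  have hdisj : ∀ k k', k ≠ k' → ∀ z ∈ N k, z ∈ N k' → z = e (0, true) := by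
    intro k k' hne z hz hz'
    obtain ⟨q, rfl⟩ := e.surjective z
    rw [hmemN] at hz hz'
    exact absurd (hz.symm.trans hz') hne
  obtain ⟨g, hg, hgpos⟩ : ∃ g : Fin d → ℝ, ∑ k, g k • W k = 0 ∧ ∀ k, 0 < g k := by
    have hdep : ¬ LinearIndependent ℝ W := fun h => by
      have := h.fintype_card_le_finrank
      simp at this
      omega
    obtain ⟨g, hg, i, hi⟩ := Fintype.not_linearIndependent_iff.1 hdep
    have hne : ∀ k, g k ≠ 0 := fun k hk => hi <|
      relation_eq_zero hv hWN hdisj hg (x := e (k, true))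
        (fun k' hk' h => hk' (by rw [← (hmemN _ _).1 h]; exact hk)) i
    rcases relation_one_signed hv hWN hdisj hg with h | h
    · exact ⟨g, hg, fun k => lt_of_le_of_ne (h k) (hne k).symm⟩
    · exact ⟨fun k => - g k, sum_neg_smul_eq_zero hg,
        fun k => neg_pos.2 (lt_of_le_of_ne (h k) (hne k))⟩
  have htop : Submodule.span ℝ (Set.range W) = ⊤ := by
    have hli := linearIndependent_deps (κ := {k : Fin d // k ≠ 0}) hv (w := fun k => W k.1)
      (N := fun k => N k.1) (c := e (0, true)) (x := e (0, true))
      (fun k => hWN k.1) (fun k k' hne => hdisj k.1 k'.1 (fun h => hne (Subtype.ext h)))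
      (fun k hk => k.2 ((hmemN _ _).1 hk).symm)
    have := hli.span_eq_top_of_card_eq_finrank' (by
      rw [Fintype.card_subtype_compl]; simp; omega)
    rw [eq_top_iff, ← this]
    exact Submodule.span_mono (by rintro _ ⟨k, rfl⟩; exact ⟨k.1, rfl⟩)
  -- The functional vanishes on the vertices chosen by `T`, so positive values go to the others.
  obtain ⟨p, hp, hpA⟩ := exists_pos_kernel (fun i j => w i (e (j, !T j)))
    (fun i j hij => hWN i _ (by rw [hmemN]; exact hij.symm)) g hgpos (fun j => by
      rw [← coe_sum_smul_apply g W, hg]; rfl)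
  obtain ⟨l, a, hl⟩ := exists_affine_functional (v := v)
    (fun x => if (e.symm x).2 = T (e.symm x).1 then 0 else p (e.symm x).1) (fun u hu => by
      have hsum : ∀ u : ι → ℝ, ∑ x, u x *
          (if (e.symm x).2 = T (e.symm x).1 then 0 else p (e.symm x).1) =
          ∑ j, u (e (j, !T j)) * p j := by
        intro u
        rw [← e.sum_comp, Fintype.sum_prod_type]
        refine Finset.sum_congr rfl fun j _ => ?_
        rw [Fintype.sum_bool]
        cases h : T j <;> simp [h]
      have hmem : (⟨u, hu⟩ : affDeps v) ∈ Submodule.span ℝ (Set.range W) := by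
        rw [htop]; trivial
      obtain ⟨f, hf⟩ := (Submodule.mem_span_range_iff_exists_fun ℝ).1 hmem
      have hu' : ∀ x, u x = ∑ k, f k * w k x := fun x => by
        rw [← coe_sum_smul_apply f W, hf]
      rw [hsum]
      simp_rw [hu', Finset.sum_mul]
      rw [Finset.sum_comm]
      refine Finset.sum_eq_zero fun k _ => ?_
      simp_rw [mul_assoc]
      rw [← Finset.mul_sum, hpA, mul_zero])
  refine ⟨-l, a, fun i => ⟨?_, ?_⟩⟩
  · have := hl (e (i, T i))
    simp at this
    simp; linarith
  · have := hl (e (i, !T i))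
    simp at this
    have := hp i
    simp; linarith

end Illum

/-! ### Convex hulls, exposed faces, and crosslike polytopes -/

namespace Illum

open Finset Module

section Convexity

variable {ι E : Type*} [Fintype ι] [NormedAddCommGroup E] [NormedSpace ℝ E]

lemma mem_convexHull_range {v : ι → E} {x : E} :
    x ∈ convexHull ℝ (Set.range v) ↔
      ∃ w : ι → ℝ, (∀ i, 0 ≤ w i) ∧ ∑ i, w i = 1 ∧ ∑ i, w i • v i = x := by
  classical
  constructor
  · intro hx
    have h : Set.range v = Fintype.linearCombination ℝ v '' Set.range
        (fun i : ι => (Pi.single i 1 : ι → ℝ)) := by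
      rw [← Set.range_comp]
      congr 1
      ext i
      simp
    rw [h, ← LinearMap.image_convexHull, convexHull_rangle_single_eq_stdSimplex] at hx
    obtain ⟨w, hw, rfl⟩ := hx
    exact ⟨w, hw.1, hw.2, rfl⟩
  · rintro ⟨w, h0, h1, rfl⟩
    exact (convex_convexHull ℝ _).sum_mem (fun i _ => h0 i) h1
      (fun i _ => subset_convexHull ℝ _ ⟨i, rfl⟩)

lemma exists_extend_of_mem_interior {A : Set E} {z : E} (hz : z ∈ interior A) (y : E) :
    ∃ ε : ℝ, 0 < ε ∧ z + ε • (z - y) ∈ A := by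
  have hcont : Filter.Tendsto (fun ε : ℝ => z + ε • (z - y)) (nhdsWithin 0 (Set.Ioi 0))
      (nhds z) := by
    have : Continuous fun ε : ℝ => z + ε • (z - y) := by fun_prop
    have h := this.tendsto 0
    rw [zero_smul, add_zero] at h
    exact h.mono_left nhdsWithin_le_nhds
  obtain ⟨ε, h, hε⟩ := ((hcont.eventually (mem_interior_iff_mem_nhds.1 hz)).and
    self_mem_nhdsWithin).exists
  exact ⟨ε, hε, h⟩

/-- An inner diagonal gives a dependence: an interior point is a convex combination of all the
vertices with positive weights, because the ray from the centroid through it continues in the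
polytope. -/
lemma isDiag_of_mem_interior {v : ι → E} {x y : ι} {z : E} (hz : z ∈ segment ℝ (v x) (v y))
    (hint : z ∈ interior (convexHull ℝ (Set.range v))) : IsDiag v x y := by
  classical
  obtain ⟨a, b, ha, hb, hab, rfl⟩ := hz
  set n : ℝ := (Fintype.card ι : ℝ) with hn
  have hn0 : 0 < n := by
    have : Nonempty ι := ⟨x⟩
    exact Nat.cast_pos.2 Fintype.card_pos
  set g : E := ∑ i, n⁻¹ • v i with hg
  obtain ⟨ε, hε, hmem⟩ := exists_extend_of_mem_interior hint g
  obtain ⟨w, hw0, hw1, hw⟩ := mem_convexHull_range.1 hmem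
  set u : ι → ℝ := fun i => w i + ε * n⁻¹
    - (1 + ε) * (a * Pi.single (M := fun _ => ℝ) x 1 i + b * Pi.single (M := fun _ => ℝ) y 1 i)
    with hu
  refine ⟨u, mem_affDeps.2 ⟨?_, ?_⟩, fun i hix hiy => ?_⟩
  · simp only [hu, Finset.sum_sub_distrib, Finset.sum_add_distrib, ← Finset.mul_sum, hw1,
      Finset.sum_pi_single', Finset.mem_univ, if_true, Finset.sum_const, Finset.card_univ,
      nsmul_eq_mul, ← hn]
    field_simp
    linear_combination (-(1 + ε)) * hab
  · simp only [hu, sub_smul, add_smul, Finset.sum_sub_distrib, Finset.sum_add_distrib, hw,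
      mul_smul, ← Finset.smul_sum, ← hg]
    simp only [Pi.single_apply, ite_smul, one_smul, zero_smul, Finset.sum_ite_eq',
      Finset.mem_univ, if_true]
    module
  · simp only [hu, Pi.single_eq_of_ne hix, Pi.single_eq_of_ne hiy]
    have := hw0 i
    have : 0 < ε * n⁻¹ := by positivity
    linarith

lemma exposed_eq_convexHull {v : ι → E} {F : Set E}
    (hF : IsExposed ℝ (convexHull ℝ (Set.range v)) F) :
    F = convexHull ℝ (v '' (v ⁻¹' F)) := by
  classical
  refine Set.Subset.antisymm (fun x hx => ?_) (convexHull_min (Set.image_preimage_subset _ _)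
    (hF.convex (convex_convexHull ℝ _)))
  obtain ⟨l, rfl⟩ := hF ⟨x, hx⟩
  obtain ⟨w, hw0, hw1, hw⟩ := mem_convexHull_range.1 hx.1
  have hle : ∀ i, l (v i) ≤ l x := fun i => hx.2 _ (subset_convexHull ℝ _ ⟨i, rfl⟩)
  have hsum : ∑ i, w i * (l x - l (v i)) = 0 := by
    have : l x = ∑ i, w i * l (v i) := by
      rw [← hw]; simp [map_sum]
    simp_rw [mul_sub]
    rw [Finset.sum_sub_distrib, ← Finset.sum_mul, hw1, one_mul, ← this, sub_self]
  have hzero := (Finset.sum_eq_zero_iff_of_nonneg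
    (fun i _ => mul_nonneg (hw0 i) (sub_nonneg.2 (hle i)))).1 hsum
  rw [← hw, ← Finset.sum_filter_of_ne (p := fun i => w i ≠ 0)
    (fun i _ h h' => h (by simp [h']))]
  refine (convex_convexHull ℝ _).sum_mem (fun i _ => hw0 i)
    (by rw [Finset.sum_filter_ne_zero, hw1]) fun i hi => subset_convexHull ℝ _ ⟨i, ?_, rfl⟩
  have hi' : l (v i) = l x := by
    rcases mul_eq_zero.1 (hzero i (mem_univ _)) with h | h
    · exact absurd h (mem_filter.1 hi).2
    · linarith
  exact ⟨subset_convexHull ℝ _ ⟨i, rfl⟩, fun y hy => hi' ▸ hx.2 y hy⟩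

lemma exposed_eq_of_mem_interior {A F : Set E} (hF : IsExposed ℝ A F) {z : E} (hz : z ∈ F)
    (hint : z ∈ interior A) : F = A := by
  refine hF.subset.antisymm fun y hy => ?_
  obtain ⟨l, rfl⟩ := hF ⟨z, hz⟩
  obtain ⟨ε, hε, hmem⟩ := exists_extend_of_mem_interior hint y
  have h := hz.2 _ hmem
  simp only [map_add, map_smul, map_sub, smul_eq_mul] at h
  have h' : l z ≤ l y := by
    by_contra hcon
    have := mul_pos hε (sub_pos.2 (not_le.1 hcon))
    linarith
  exact ⟨hy, fun y' hy' => (hz.2 y' hy').trans h'⟩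

end Convexity

variable {d : ℕ} {P : Set (EuclideanSpace ℝ (Fin d))} {v : Fin d × Bool → EuclideanSpace ℝ (Fin d)}

/-- The points `v (i, b)` span `P` like the vertices of a crosspolytope: each antipodal pair
`v (i, true)`, `v (i, false)` spans an inner diagonal, and each transversal of the antipodal pairs is
cut out by a supporting hyperplane. -/
structure IsCrosslike (P : Set (EuclideanSpace ℝ (Fin d)))
    (v : Fin d × Bool → EuclideanSpace ℝ (Fin d)) : Prop where
  hull : P = convexHull ℝ (Set.range v)
  diag : ∀ i, ∃ z ∈ segment ℝ (v (i, true)) (v (i, false)), z ∈ interior P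
  facet : ∀ T : Fin d → Bool, ∃ (l : EuclideanSpace ℝ (Fin d) →L[ℝ] ℝ) (a : ℝ),
    ∀ i, l (v (i, T i)) = a ∧ l (v (i, !T i)) < a

/-- The vertex sets of faces of a crosspolytope with vertices labelled by `Fin d × Bool`: the whole
vertex set, and the sets without antipodal vertices. -/
def IsCrossFace (S : Set (Fin d × Bool)) : Prop :=
  S = Set.univ ∨ ∀ i, ¬ ((i, true) ∈ S ∧ (i, false) ∈ S)

namespace IsCrosslike

lemma mem (h : IsCrosslike P v) (q : Fin d × Bool) : v q ∈ P := by
  rw [h.hull]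
  exact subset_convexHull ℝ _ ⟨q, rfl⟩

lemma isCrossFace_preimage (h : IsCrosslike P v) {F : Set (EuclideanSpace ℝ (Fin d))}
    (hF : IsExposed ℝ P F) : IsCrossFace (v ⁻¹' F) := by
  by_cases hex : ∃ i, (i, true) ∈ v ⁻¹' F ∧ (i, false) ∈ v ⁻¹' F
  · left
    obtain ⟨i, h1, h2⟩ := hex
    obtain ⟨z, hz, hint⟩ := h.diag i
    have hconv : Convex ℝ P := by rw [h.hull]; exact convex_convexHull ℝ _
    rw [exposed_eq_of_mem_interior hF ((hF.convex hconv).segment_subset h1 h2 hz) hint]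
    ext q
    simp [h.mem q]
  · right
    exact fun i hi => hex ⟨i, hi⟩

lemma exists_facet (h : IsCrosslike P v) (T : Fin d → Bool) :
    ∃ F, IsExposed ℝ P F ∧ ∀ i b, v (i, b) ∈ F ↔ b = T i := by
  obtain ⟨l, a, hl⟩ := h.facet T
  refine ⟨{x ∈ P | ∀ y ∈ P, l y ≤ l x}, fun _ => ⟨l, rfl⟩, fun i b => ⟨fun hb => ?_, ?_⟩⟩
  · by_contra hne
    obtain rfl := Bool.eq_not.2 hne
    have := hb.2 _ (h.mem (i, T i))
    linarith [(hl i).1, (hl i).2]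
  · rintro rfl
    refine ⟨h.mem _, fun y hy => ?_⟩
    rw [(hl i).1]
    rw [h.hull] at hy
    refine convexHull_min (t := {y | l y ≤ a}) ?_ (convex_halfSpace_le l.isLinear a) hy
    rintro _ ⟨⟨j, b⟩, rfl⟩
    by_cases hb : b = T j
    · subst hb; exact (hl j).1.le
    · obtain rfl := Bool.eq_not.2 hb
      exact (hl j).2.le

/-- A set without antipodal vertices is the intersection of the transversals that contain it. -/
lemma exists_face (h : IsCrosslike P v) {S : Set (Fin d × Bool)} (hS : IsCrossFace S) :
    ∃ F, IsExposed ℝ P F ∧ v ⁻¹' F = S := by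
  classical
  rcases hS with rfl | hS
  · refine ⟨P, IsExposed.refl P, ?_⟩
    ext q
    simp [h.mem q]
  choose F hF hmem using h.exists_facet
  set 𝒯 : Finset (Fin d → Bool) := univ.filter fun T => ∀ q ∈ S, q.2 = T q.1 with h𝒯
  have hT : ∀ (i : Fin d) (b : Bool), (i, !b) ∉ S →
      ∃ T ∈ 𝒯, T i = b := by
    intro i b hb
    refine ⟨fun j => if j = i then b else decide ((j, true) ∈ S), ?_, by simp⟩
    simp only [h𝒯, mem_filter, mem_univ, true_and]
    rintro ⟨j, b'⟩ hj
    by_cases hji : j = i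
    · subst hji
      cases b <;> cases b' <;> simp_all
    · have := hS j
      cases b' <;> simp_all
  by_cases hne : 𝒯.Nonempty
  · refine ⟨⋂₀ ((𝒯.image F : Finset _) : Set _), IsExposed.sInter (hne.image F) ?_, ?_⟩
    · intro B hB
      obtain ⟨T, -, rfl⟩ := mem_image.1 hB
      exact hF T
    · ext ⟨i, b⟩
      simp only [Set.mem_preimage, Set.mem_sInter, Finset.coe_image, Set.forall_mem_image,
        Finset.mem_coe, hmem]
      constructor
      · intro hall
        by_contra hib
        obtain ⟨T, hT1, hT2⟩ := hT i (!b) (by simpa using hib)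
        have := hall hT1
        rw [hT2] at this
        cases b <;> simp at this
      · intro hib T hT'
        exact (mem_filter.1 hT').2 _ hib
  · refine absurd ⟨fun j => decide ((j, true) ∈ S), ?_⟩ hne
    simp only [h𝒯, mem_filter, mem_univ, true_and]
    rintro ⟨j, b'⟩ hj
    have := hS j
    cases b' <;> simp_all

/-- The face lattice of a crosslike polytope depends only on the dimension. -/
lemma nonempty_orderIso (h : IsCrosslike P v) :
    Nonempty (Face P ≃o {S : Set (Fin d × Bool) // IsCrossFace S}) := by
  have hhull : ∀ F, IsExposed ℝ P F → F = convexHull ℝ (v '' (v ⁻¹' F)) := fun F hF => by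
    rw [h.hull] at hF
    exact exposed_eq_convexHull hF
  let f : Face P ↪o {S : Set (Fin d × Bool) // IsCrossFace S} :=
    OrderEmbedding.ofMapLEIff (fun F => ⟨v ⁻¹' F.1, h.isCrossFace_preimage F.2⟩) fun F G => by
      refine ⟨fun hFG => ?_, fun hFG => Set.preimage_mono hFG⟩
      change F.1 ⊆ G.1
      rw [hhull F.1 F.2, hhull G.1 G.2]
      exact convexHull_mono (Set.image_mono hFG)
  refine ⟨RelIso.ofSurjective f ?_⟩
  rintro ⟨S, hS⟩
  obtain ⟨F, hF, hFS⟩ := h.exists_face hS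
  exact ⟨⟨F, hF⟩, Subtype.ext hFS⟩

lemma exposed_singleton (h : IsCrosslike P v) (q : Fin d × Bool) :
    IsExposed ℝ P {v q} ∧ v ⁻¹' {v q} = {q} := by
  obtain ⟨F, hF, hFq⟩ := h.exists_face (S := {q}) (Or.inr fun i hi => by
    simp only [Set.mem_singleton_iff] at hi
    simpa using hi.1.trans hi.2.symm)
  have hF' : F = {v q} := by
    have := hF
    rw [h.hull] at this
    rw [exposed_eq_convexHull this, hFq, Set.image_singleton, convexHull_singleton]
  exact hF' ▸ ⟨hF, hFq⟩

lemma injective (h : IsCrosslike P v) : Function.Injective v := fun q q' hq => by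
  have : q ∈ v ⁻¹' {v q'} := hq
  rwa [(h.exposed_singleton q').2] at this

lemma verts_eq (h : IsCrosslike P v) : verts P = Set.range v := by
  refine Set.Subset.antisymm ?_ ?_
  · rw [verts, h.hull]
    exact extremePoints_convexHull_subset
  · rintro _ ⟨q, rfl⟩
    exact (h.exposed_singleton q).1.isExtreme.mem_extremePoints

lemma f₀_eq (h : IsCrosslike P v) : f₀ P = 2 * d := by
  rw [f₀, h.verts_eq, ← Set.image_univ, Set.ncard_image_of_injective _ h.injective,
    Set.ncard_univ]
  simp [mul_comm]

lemma isIlluminated (h : IsCrosslike P v) (hd : 1 ≤ d) : IsIlluminated d P := by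
  refine ⟨⟨⟨_, Set.finite_range v, h.hull⟩, ?_⟩, ?_⟩
  · obtain ⟨z, -, hz⟩ := h.diag ⟨0, hd⟩
    exact ⟨z, hz⟩
  · intro x hx
    rw [h.verts_eq] at hx
    obtain ⟨⟨i, b⟩, rfl⟩ := hx
    obtain ⟨z, hz, hint⟩ := h.diag i
    refine ⟨v (i, true), v (i, false), ⟨?_, ?_, ?_, z, hz, hint⟩, ?_⟩
    · rw [h.verts_eq]; exact ⟨_, rfl⟩
    · rw [h.verts_eq]; exact ⟨_, rfl⟩
    · exact fun heq => by simpa using h.injective heq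
    · cases b
      · exact right_mem_segment ℝ _ _
      · exact left_mem_segment ℝ _ _

end IsCrosslike

/-- The crosspolytope is `{x | ∑ |x i| ≤ 1}`; only this inclusion is needed. -/
lemma mem_crosspolytope (hd : 1 ≤ d) {x : EuclideanSpace ℝ (Fin d)} (hx : ∑ i, |x i| ≤ 1) :
    x ∈ convexHull ℝ (Set.range fun q : Fin d × Bool =>
      (if q.2 then (1 : ℝ) else -1) • EuclideanSpace.single q.1 (1 : ℝ)) := by
  have hd0 : (0 : ℝ) < d := by exact_mod_cast hd
  -- The slack `1 - ∑ |x i|` is spread evenly over all vertices, whose sum is zero.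
  refine mem_convexHull_range.2 ⟨fun q => (|x q.1| + (if q.2 then 1 else -1) * x q.1) / 2
    + (1 - ∑ i, |x i|) / (2 * d), fun q => ?_, ?_, ?_⟩
  · have h1 : 0 ≤ (1 - ∑ i, |x i|) / (2 * d) := div_nonneg (by linarith) (by positivity)
    have h2 := neg_abs_le (x q.1)
    have h3 := le_abs_self (x q.1)
    beta_reduce
    split_ifs <;> linarith
  · rw [Fintype.sum_prod_type]
    simp only [Fintype.sum_bool, if_true, Bool.false_eq_true, if_false]
    have : ∀ i, (|x i| + 1 * x i) / 2 + (1 - ∑ i, |x i|) / (2 * d) +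
        ((|x i| + -1 * x i) / 2 + (1 - ∑ i, |x i|) / (2 * d)) =
        |x i| + (1 - ∑ i, |x i|) / d := fun i => by field_simp; ring
    simp_rw [this]
    rw [Finset.sum_add_distrib, Finset.sum_const, Finset.card_univ, Fintype.card_fin,
      nsmul_eq_mul]
    field_simp
    ring
  · rw [Fintype.sum_prod_type]
    simp only [Fintype.sum_bool, if_true, Bool.false_eq_true, if_false]
    ext j
    simp only [PiLp.add_apply, PiLp.smul_apply, PiLp.single_apply, WithLp.ofLp_sum,
      Finset.sum_apply, smul_eq_mul]
    rw [Finset.sum_eq_single j]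
    · simp
      ring
    · intro b _ hb
      simp [hb.symm]
    · simp

lemma isCrosslike_crosspolytope (hd : 1 ≤ d) :
    IsCrosslike (crosspolytope d) (fun q : Fin d × Bool =>
      (if q.2 then (1 : ℝ) else -1) • EuclideanSpace.single q.1 (1 : ℝ)) := by
  have hhull : crosspolytope d = convexHull ℝ (Set.range fun q : Fin d × Bool =>
      (if q.2 then (1 : ℝ) else -1) • EuclideanSpace.single q.1 (1 : ℝ)) := by
    rw [crosspolytope]
    congr 1
    ext x
    simp [Prod.exists, Bool.exists_bool, exists_or, or_comm]
  refine ⟨hhull, fun i => ⟨0, ?_, ?_⟩, fun T => ?_⟩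
  · exact ⟨1 / 2, 1 / 2, by norm_num, by norm_num, by norm_num, by simp⟩
  · rw [mem_interior]
    refine ⟨{x | ∑ i, |x i| < 1}, fun x hx => ?_, ?_, by simp⟩
    · rw [hhull]
      exact mem_crosspolytope hd (le_of_lt hx)
    · exact isOpen_lt (by fun_prop) continuous_const
  · have hl : ∀ i, (∑ j, (if T j then (1 : ℝ) else -1) •
        (EuclideanSpace.proj j : EuclideanSpace ℝ (Fin d) →L[ℝ] ℝ)) (EuclideanSpace.single i 1) =
        if T i then 1 else -1 := fun i => by
      rw [_root_.sum_apply, Finset.sum_eq_single i]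
      · split_ifs <;> simp
      · intro j _ hj
        split_ifs <;> simp [hj]
      · simp
    refine ⟨∑ j, (if T j then (1 : ℝ) else -1) •
      (EuclideanSpace.proj j : EuclideanSpace ℝ (Fin d) →L[ℝ] ℝ), 1, fun i => ?_⟩
    rw [map_smul, map_smul, hl]
    cases h : T i <;> norm_num

/-- An illuminated `d`-polytope with at most `2 d` vertices, `d ≤ 5`, is crosslike. -/
lemma exists_isCrosslike (hd₁ : 1 ≤ d) (hd₅ : d ≤ 5) (hP : IsIlluminated d P)
    (hf : f₀ P ≤ 2 * d) : ∃ v, IsCrosslike P v := by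
  obtain ⟨⟨⟨V, hV, rfl⟩, hint⟩, hill⟩ := hP
  set P := convexHull ℝ V with hPdef
  have hfin : (verts P).Finite := hV.subset (extremePoints_convexHull_subset (𝕜 := ℝ))
  have hhull : P = convexHull ℝ (verts P) := by
    have := closure_convexHull_extremePoints (s := P) (hV.isCompact_convexHull ℝ)
      (convex_convexHull ℝ _)
    change closure (convexHull ℝ (verts P)) = P at this
    rwa [(hfin.isClosed_convexHull ℝ).closure_eq, eq_comm] at this
  have : Fintype (verts P) := hfin.fintype
  set u : verts P → EuclideanSpace ℝ (Fin d) := Subtype.val with hu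
  have hrange : Set.range u = verts P := Subtype.range_coe
  have hhull' : P = convexHull ℝ (Set.range u) := by rw [hrange]; exact hhull
  have hind : ConvexIndependent ℝ u := (convex_convexHull ℝ V).convexIndependent_extremePoints
  have hspan : affineSpan ℝ (Set.range u) = ⊤ := by
    rw [← interior_convexHull_nonempty_iff_affineSpan_eq_top, ← hhull']
    exact hint
  have hrank : finrank ℝ (EuclideanSpace ℝ (Fin d)) = d := by simp
  let R : verts P → verts P → Prop := fun x y => ∃ z ∈ segment ℝ (u x) (u y), z ∈ interior P
  have hsymm : ∀ x y, R x y → R y x := by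
    rintro x y ⟨z, hz, hzi⟩
    exact ⟨z, segment_symm ℝ (u x) (u y) ▸ hz, hzi⟩
  have hdiag : ∀ x y, R x y → IsDiag u x y := by
    rintro x y ⟨z, hz, hzi⟩
    exact isDiag_of_mem_interior hz (hhull' ▸ hzi)
  have hcard : Fintype.card (verts P) = f₀ P := by
    rw [f₀, ← Nat.card_coe_set_eq, Nat.card_eq_fintype_card]
  have hR : ∀ x, ∃ y, y ≠ x ∧ R x y := by
    intro x
    obtain ⟨p, q, ⟨hp, hq, hpq, z, hz, hzi⟩, hx⟩ := hill x.1 x.2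
    have hD : R ⟨p, hp⟩ ⟨q, hq⟩ := ⟨z, hz, hzi⟩
    rcases (mem_extremePoints_iff_forall_segment.1 x.2).2 p hp.1 q hq.1 hx with h | h
    · obtain rfl : (⟨p, hp⟩ : verts P) = x := Subtype.ext h
      exact ⟨⟨q, hq⟩, fun h => hpq (congrArg Subtype.val h).symm, hD⟩
    · obtain rfl : (⟨q, hq⟩ : verts P) = x := Subtype.ext h
      exact ⟨⟨p, hp⟩, fun h => hpq (congrArg Subtype.val h), hsymm _ _ hD⟩
  obtain ⟨e, he⟩ := exists_diag_matching hind hspan hrank hd₁ hd₅ hsymm hdiag hR (by omega)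
  refine ⟨u ∘ e, by rw [e.surjective.range_comp]; exact hhull', he, fun T => ?_⟩
  obtain ⟨l, a, hl⟩ := exists_functional_of_matching hind hspan hrank hd₁ e
    (fun i => hdiag _ _ (he i)) T
  exact ⟨LinearMap.toContinuousLinearMap l, a, hl⟩

end Illum

/-! ### The crosspolytope is the unique Mani polytope in low dimensions -/

namespace Illum

lemma maniNumber_eq {d : ℕ} (hd₁ : 1 ≤ d) (hd₅ : d ≤ 5) : maniNumber d = 2 * d := by
  refine min_eq_left ?_
  have hd₁' : (1 : ℝ) ≤ d := by exact_mod_cast hd₁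
  have hd₅' : (d : ℝ) ≤ 5 := by exact_mod_cast hd₅
  have hsq : Real.sqrt d ^ 2 = d := Real.sq_sqrt (by linarith)
  have hsq1 : 1 ≤ Real.sqrt d := Real.one_le_sqrt.2 hd₁'
  have hsq2 : Real.sqrt d ≤ 5 / 2 := by nlinarith
  -- For `t = √d` this is `t ^ 2 < 2 t + 2`, which holds on `[1, 5 / 2]`.
  have hlt : ((2 * d - 1 : ℕ) : ℝ) < (Real.sqrt d + 1) ^ 2 := by
    rw [Nat.cast_sub (by omega)]
    push_cast
    nlinarith
  have := Nat.lt_ceil.2 hlt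
  omega

end Illum

theorem theorem2 (d : ℕ) (hd₁ : 1 ≤ d) (hd₅ : d ≤ 5) :
    Illum.IsMani d (Illum.crosspolytope d) ∧
      ∀ P : Set (EuclideanSpace ℝ (Fin d)), Illum.IsMani d P →
        Illum.CombEquiv P (Illum.crosspolytope d) := by
  have hM := Illum.maniNumber_eq hd₁ hd₅
  have hcross := Illum.isCrosslike_crosspolytope hd₁
  refine ⟨⟨hcross.isIlluminated hd₁, by rw [hcross.f₀_eq, hM], fun Q hQ => ?_⟩, fun P hP => ?_⟩
  · rw [hcross.f₀_eq]
    by_contra! hlt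
    obtain ⟨v, hv⟩ := Illum.exists_isCrosslike hd₁ hd₅ hQ hlt.le
    exact hlt.ne hv.f₀_eq
  · obtain ⟨v, hv⟩ := Illum.exists_isCrosslike hd₁ hd₅ hP.1 (by rw [hP.2.1, hM])
    obtain ⟨f⟩ := hv.nonempty_orderIso
    obtain ⟨g⟩ := hcross.nonempty_orderIso
    exact ⟨f.trans g.symm⟩
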